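/- Theorem (Generalized adiabatic theorem). Let $\mathcal H$ be a complex Hilbert space, let $T>0$, write $\|F\|_{\infty,T}=\sup_{s\in[0,T]}\|F(s)\|\in[0,\infty]$ (operator norm), let a dot denote the derivative on $[0,T]$ (one-sided at the end points), and let $\mathcal T\exp\bigl(-\mathrm i\int_0^t\mathrm ds\,K(s)\bigr)$ denote the time-ordered exponential (the sum of the Dyson series) generated by $K$. Let $H_0(t)=\sum_{\ell=1}^m E_\ell(t)P_\ell(t)$ for every $t\in[0,T]$, where $E_\ell(t)\in\mathbb R$, $P_\ell(t)=P_\ell(t)^\dagger$, $P_k(t)P_\ell(t)=\delta_{k\ell}P_\ell(t)$, $\sum_\ell P_\ell(t)=1$, the functions $E_\ell$ are $C^1$ and $P_\ell$ are $C^2$ (in operator norm) on $[0,T]$, and $E_k(t)\neq E_\ell(t)$ for all $k\ne\ell$, $t\in[0,T]$. Put $$A=\sum_{\ell}\frac{\mathrm i}{2}[\dot P_\ell,P_\ell],\qquad \eta=\min_{k\ne\ell}\min_{t\in[0,T]}|E_k(t)-E_\ell(t)|,\qquad \eta'=\max_{k\ne\ell}\max_{t\in[0,T]}|\dot E_k(t)-\dot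 E_\ell(t)|$$ (with $\eta=\infty$, $1/\eta=0$, $\eta'=0$, and right-hand side of the bound below equal to $0$, if there is only one level). For every $\kappa>0$ let $t\in[0,T]\mapsto H_\kappa(t)$ be an integrable family of bounded self-adjoint operators, and let $U_\kappa(t)=\mathcal T\exp\bigl(-\mathrm i\int_0^t\mathrm ds\,H_\kappa(s)\bigr)$. Assume that $\frac1\kappa H_\kappa(t)\to H_0(t)$ in norm as $\kappa\to+\infty$ for every $t\in[0,T]$, that $G_\kappa=H_\kappa-\kappa H_0$ is differentiable on $[0,T]$ for every $\kappa>0$, and that $\|G_\kappa\|_{\infty,T}$ and $\|\dot G_\kappa\|_{\infty,T}$ are both $o(\sqrt\kappa)$ as $\kappa\to+\infty$. Let $G_{\kappa,Z}(t)=\sum_\ell P_\ell(t)G_\kappa(t)P_\ell(t)$ and $$V_\kappa(t)=\mathcal T\exp\Bigl(-\mathrm i\int_0^t\mathrm ds\,[\kappa H_0(s)+G_{\kappa,Z}(s)+A(s)]\Bigr).$$ Then $U_\kappa(t)-V_\kappa(t)\to0$ in norm as $\kappa\to+\infty$, uniformly for $t\in[0,T]$, and for all $\kappa>0$ and $t\in[0,T]$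 $$\|U_\kappa(t)-V_\kappa(t)\|\le\frac{\sqrt m}{\kappa\eta}\bigl(1+T\|A\|_{\infty,T}+2T\|G_\kappa\|_{\infty,T}\bigr)\Bigl[\Bigl(2+\frac{\eta'}{\eta}T\Bigr)\bigl(\|A\|_{\infty,T}+\|G_\kappa\|_{\infty,T}\bigr)+T\bigl(\|\dot A\|_{\infty,T}+\|\dot G_\kappa\|_{\infty,T}+2\|A\|_{\infty,T}\|G_\kappa\|_{\infty,T}\bigr)\Bigr].$$ In particular (strong-coupling limit with time-dependent Hamiltonians), if $H_1(t)$ is bounded and self-adjoint for $t\in[0,T]$ and $H_1$ is differentiable on $[0,T]$ with $\|\dot H_1\|_{\infty,T}<\infty$, then the same uniform convergence and, for all $\kappa>0$ and $t\in[0,T]$, the same bound hold for $H_\kappa=\kappa H_0+H_1$, with $G_\kappa$ replaced by $H_1$. -/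

import Mathlib

noncomputable section

namespace GenAdiabatic

open Set
open scoped ENNReal

variable {𝓗 : Type*} [NormedAddCommGroup 𝓗] [InnerProductSpace ℂ 𝓗] [CompleteSpace 𝓗]

/-- The terms of the Dyson series of `H`:
`D₀(t) = 1` and `Dₙ₊₁(t) = -i ∫₀ᵗ H(s) Dₙ(s) ds`. -/
def dyson (H : ℝ → 𝓗 →L[ℂ] 𝓗) : ℕ → ℝ → 𝓗 →L[ℂ] 𝓗
  | 0, _ => 1
  | n + 1, t => (-Complex.I) • ∫ s in (0 : ℝ)..t, H s * dyson H n s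

/-- The time-ordered exponential `𝒯 exp(-i ∫₀ᵗ H(s) ds)`, as the sum of the Dyson series. -/
def timeOrderedExp (H : ℝ → 𝓗 →L[ℂ] 𝓗) (t : ℝ) : 𝓗 →L[ℂ] 𝓗 :=
  ∑' n, dyson H n t

/-- `‖F‖_{∞,T} = sup_{s ∈ [0,T]} ‖F(s)‖`, with value `∞` when `F` is unbounded on `[0,T]`. -/
def supNorm {X : Type*} [NormedAddCommGroup X] (T : ℝ) (F : ℝ → X) : ℝ≥0∞ :=
  ⨆ s ∈ Icc (0 : ℝ) T, ‖F s‖ₑ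

/-- The time derivative on `[0,T]` (one-sided at the end points). -/
def timeDeriv {X : Type*} [NormedAddCommGroup X] [NormedSpace ℝ X] (T : ℝ) (F : ℝ → X) (t : ℝ) :
    X :=
  derivWithin F (Icc (0 : ℝ) T) t

/-- `H₀(t) = ∑ₗ Eₗ(t) Pₗ(t)` is a finite spectral representation for every `t ∈ [0,T]`, with `C¹`
eigenvalues, `C²` spectral projections and no level crossings. -/
structure IsAdiabatic {m : ℕ} (T : ℝ) (H₀ : ℝ → 𝓗 →L[ℂ] 𝓗) (E : Fin m → ℝ → ℝ)
    (P : Fin m → ℝ → 𝓗 →L[ℂ] 𝓗) : Prop where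
  spectral : ∀ t ∈ Icc (0 : ℝ) T, H₀ t = ∑ l, (E l t : ℂ) • P l t
  selfAdjoint : ∀ l, ∀ t ∈ Icc (0 : ℝ) T, IsSelfAdjoint (P l t)
  orthogonal : ∀ k l, ∀ t ∈ Icc (0 : ℝ) T, P k t * P l t = if k = l then P l t else 0
  complete : ∀ t ∈ Icc (0 : ℝ) T, ∑ l, P l t = 1
  contDiff_E : ∀ l, ContDiffOn ℝ 1 (E l) (Icc (0 : ℝ) T)
  contDiff_P : ∀ l, ContDiffOn ℝ 2 (P l) (Icc (0 : ℝ) T)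
  noCrossing : ∀ k l, k ≠ l → ∀ t ∈ Icc (0 : ℝ) T, 0 < |E k t - E l t|

/-- The minimal spectral gap `η = min_{k ≠ l} min_{t ∈ [0,T]} |Eₖ(t) - Eₗ(t)|`
(`∞` if there is only one level). -/
def minGap {m : ℕ} (T : ℝ) (E : Fin m → ℝ → ℝ) : ℝ≥0∞ :=
  ⨅ (k : Fin m) (l : Fin m) (_ : k ≠ l), ⨅ t ∈ Icc (0 : ℝ) T, ‖E k t - E l t‖ₑ

/-- The maximal spectral slope `η' = max_{k ≠ l} max_{t ∈ [0,T]} |d/dt (Eₖ - Eₗ)(t)|`. -/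
def maxSlope {m : ℕ} (T : ℝ) (E : Fin m → ℝ → ℝ) : ℝ≥0∞ :=
  ⨆ (k : Fin m) (l : Fin m) (_ : k ≠ l), supNorm T (timeDeriv T (fun t => E k t - E l t))

/-- The adiabatic connection `A(t) = ∑ₗ (i/2) [Ṗₗ(t), Pₗ(t)]`. -/
def connection {m : ℕ} (T : ℝ) (P : Fin m → ℝ → 𝓗 →L[ℂ] 𝓗) (t : ℝ) : 𝓗 →L[ℂ] 𝓗 :=
  ∑ l, (Complex.I / 2) • (timeDeriv T (P l) t * P l t - P l t * timeDeriv T (P l) t)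

/-- The Zeno Hamiltonian `G_Z(t) = ∑ₗ Pₗ(t) G(t) Pₗ(t)`. -/
def zeno {m : ℕ} (P : Fin m → ℝ → 𝓗 →L[ℂ] 𝓗) (G : ℝ → 𝓗 →L[ℂ] 𝓗) (t : ℝ) : 𝓗 →L[ℂ] 𝓗 :=
  ∑ l, P l t * G t * P l t

/-- `G_κ(t) = H_κ(t) - κ H₀(t)`. -/
def remainder (H : ℝ → ℝ → 𝓗 →L[ℂ] 𝓗) (H₀ : ℝ → 𝓗 →L[ℂ] 𝓗) (κ t : ℝ) : 𝓗 →L[ℂ] 𝓗 :=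
  H κ t - (κ : ℂ) • H₀ t

/-- The evolution generated by `κ H₀ + G_Z + A`. -/
def adiabaticEvolution {m : ℕ} (T : ℝ) (H₀ : ℝ → 𝓗 →L[ℂ] 𝓗) (P : Fin m → ℝ → 𝓗 →L[ℂ] 𝓗)
    (G : ℝ → 𝓗 →L[ℂ] 𝓗) (κ : ℝ) : ℝ → 𝓗 →L[ℂ] 𝓗 :=
  timeOrderedExp fun s => (κ : ℂ) • H₀ s + zeno P G s + connection T P s

/-- The error bound
`√m / (κ η) (1 + T‖A‖ + 2T‖G‖) [(2 + (η'/η) T)(‖A‖ + ‖G‖) + T(‖Ȧ‖ + ‖Ġ‖ + 2‖A‖‖G‖)]`,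
all norms being `‖·‖_{∞,T}`. -/
def errorBound {m : ℕ} (T : ℝ) (E : Fin m → ℝ → ℝ) (P : Fin m → ℝ → 𝓗 →L[ℂ] 𝓗)
    (G : ℝ → 𝓗 →L[ℂ] 𝓗) (κ : ℝ) : ℝ≥0∞ :=
  ENNReal.ofReal (Real.sqrt m) / (ENNReal.ofReal κ * minGap T E)
    * (1 + ENNReal.ofReal T * supNorm T (connection T P) + 2 * ENNReal.ofReal T * supNorm T G)
    * ((2 + maxSlope T E / minGap T E * ENNReal.ofReal T)
          * (supNorm T (connection T P) + supNorm T G)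
        + ENNReal.ofReal T
          * (supNorm T (timeDeriv T (connection T P)) + supNorm T (timeDeriv T G)
              + 2 * supNorm T (connection T P) * supNorm T G))

end GenAdiabatic

end

/-!
The connection `A` generates the motion of the projections, `Ṗₗ = [-iA, Pₗ]`, and is purely
off-diagonal with respect to them. Hence `G - A - G_Z` is off-diagonal too, and therefore a
commutator `[H₀, Y]`: divide its `(k, l)` block by `Eₖ - Eₗ`. As a consequence `1 + κ⁻¹Y`
intertwines the generators `κH₀ + G` and `κH₀ + G_Z + A` up to `O(κ⁻¹)`, and since `U` and `V` are
unitary, `V†(1 + κ⁻¹Y)U` moves at speed `O(κ⁻¹)` only. This bounds `V†U - 1`, with a constant that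
is quadratic in `G` and linear in `Ġ`, whence the condition `o(√κ)`. The factor `√m` is the price of
dividing blocks by the level spacings in operator norm: each of the `m` block rows is multiplied by
a diagonal operator of norm at most `η⁻¹`, and the rows are mutually orthogonal.
-/

namespace GenAdiabatic

open Set Filter Topology
open scoped ENNReal

section Dyson

variable {𝓗 : Type*} [NormedAddCommGroup 𝓗] [InnerProductSpace ℂ 𝓗] {H K : ℝ → 𝓗 →L[ℂ] 𝓗} {T : ℝ}

lemma dyson_congr (h : EqOn H K (Icc 0 T)) (n : ℕ) :
    EqOn (dyson H n) (dyson K n) (Icc 0 T) := by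
  induction n with
  | zero => exact fun _ _ => rfl
  | succ n ih =>
    refine fun t ht => congrArg ((-Complex.I) • ·) (intervalIntegral.integral_congr fun s hs => ?_)
    rw [uIcc_of_le ht.1] at hs
    have hsT : s ∈ Icc 0 T := Icc_subset_Icc_right ht.2 hs
    simp only [h hsT, ih hsT]

lemma timeOrderedExp_congr (h : EqOn H K (Icc 0 T)) :
    EqOn (timeOrderedExp H) (timeOrderedExp K) (Icc 0 T) := fun _ ht =>
  tsum_congr fun n => dyson_congr h n ht

lemma timeOrderedExp_zero (H : ℝ → 𝓗 →L[ℂ] 𝓗) : timeOrderedExp H 0 = 1 := by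
  rw [timeOrderedExp, tsum_eq_single 0 fun n hn => ?_, dyson]
  obtain ⟨k, rfl⟩ := Nat.exists_eq_succ_of_ne_zero hn
  simp [dyson]

variable [CompleteSpace 𝓗]

lemma continuous_dyson (hH : Continuous H) (n : ℕ) : Continuous (dyson H n) := by
  induction n with
  | zero => exact continuous_const
  | succ n ih =>
    exact (intervalIntegral.continuous_primitive
      (fun a b => (hH.mul ih).intervalIntegrable a b) 0).const_smul (-Complex.I)

lemma hasDerivAt_dyson_succ (hH : Continuous H) (n : ℕ) (t : ℝ) :
    HasDerivAt (dyson H (n + 1)) ((-Complex.I) • (H t * dyson H n t)) t :=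
  ((hH.mul (continuous_dyson hH n)).integral_hasStrictDerivAt 0 t).hasDerivAt.const_smul
    (-Complex.I)

lemma norm_dyson_le {M : ℝ} (hM : ∀ s, ‖H s‖ ≤ M) (n : ℕ) (t : ℝ) :
    ‖dyson H n t‖ ≤ (M * |t|) ^ n / n.factorial := by
  induction n generalizing t with
  | zero =>
    simp only [dyson, pow_zero, Nat.factorial_zero, Nat.cast_one, div_one]
    exact ContinuousLinearMap.norm_id_le
  | succ n ih =>
    have hpow : MeasureTheory.IntegrableOn (fun s : ℝ => M ^ (n + 1) / n.factorial * |s - 0| ^ n)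
        (uIoc 0 t) :=
      (Continuous.integrableOn_uIcc (by fun_prop)).mono_set uIoc_subset_uIcc
    calc ‖dyson H (n + 1) t‖ = ‖∫ s in (0 : ℝ)..t, H s * dyson H n s‖ := by
          simp [dyson, norm_smul]
      _ ≤ ∫ s in uIoc 0 t, ‖H s * dyson H n s‖ :=
          intervalIntegral.norm_integral_le_integral_norm_uIoc
      _ ≤ ∫ s in uIoc 0 t, M ^ (n + 1) / n.factorial * |s - 0| ^ n := by
          refine MeasureTheory.integral_mono_of_nonneg (.of_forall fun _ => norm_nonneg _) hpow
            (.of_forall fun s => ?_)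
          calc ‖H s * dyson H n s‖ ≤ M * ((M * |s|) ^ n / n.factorial) :=
                norm_mul_le_of_le (hM s) (ih s)
            _ = M ^ (n + 1) / n.factorial * |s - 0| ^ n := by rw [sub_zero]; ring
      _ = (M * |t|) ^ (n + 1) / (n + 1).factorial := by
          rw [MeasureTheory.integral_const_mul, integral_pow_abs_sub_uIoc, sub_zero,
            Nat.factorial_succ]
          push_cast
          field_simp
          rw [mul_pow]

lemma summable_dyson {M : ℝ} (hM : ∀ s, ‖H s‖ ≤ M) (t : ℝ) : Summable fun n => dyson H n t :=
  .of_norm_bounded (Real.summable_pow_div_factorial (M * |t|)) fun n => norm_dyson_le hM n t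

lemma hasDerivAt_tsum_dyson_succ (hH : Continuous H) {M : ℝ} (hM : ∀ s, ‖H s‖ ≤ M) (t : ℝ) :
    HasDerivAt (fun s => ∑' n, dyson H (n + 1) s) (∑' n, (-Complex.I) • (H t * dyson H n t)) t := by
  have hM0 : 0 ≤ M := (norm_nonneg _).trans (hM 0)
  have h0 : Summable fun n => dyson H (n + 1) 0 :=
    (summable_nat_add_iff (f := fun n => dyson H n 0) 1).2 (summable_dyson hM 0)
  have hbound : ∀ (n : ℕ), ∀ s ∈ Ioo (-(|t| + 1)) (|t| + 1),
      ‖(-Complex.I) • (H s * dyson H n s)‖ ≤ M * ((M * (|t| + 1)) ^ n / n.factorial) := by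
    intro n s hs
    calc ‖(-Complex.I) • (H s * dyson H n s)‖ = ‖H s * dyson H n s‖ := by simp [norm_smul]
      _ ≤ M * ((M * |s|) ^ n / n.factorial) := norm_mul_le_of_le (hM s) (norm_dyson_le hM n s)
      _ ≤ M * ((M * (|t| + 1)) ^ n / n.factorial) := by gcongr; exact (abs_lt.2 hs).le
  exact hasDerivAt_tsum_of_isPreconnected (g := fun n => dyson H (n + 1))
    ((Real.summable_pow_div_factorial _).mul_left M) isOpen_Ioo isPreconnected_Ioo
    (fun n s _ => hasDerivAt_dyson_succ hH n s) hbound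
    (abs_lt.1 (by rw [abs_zero]; positivity)) h0 (abs_lt.1 (lt_add_one |t|))

lemma hasDerivAt_timeOrderedExp (hH : Continuous H) {M : ℝ} (hM : ∀ s, ‖H s‖ ≤ M) (t : ℝ) :
    HasDerivAt (timeOrderedExp H) ((-Complex.I) • (H t * timeOrderedExp H t)) t := by
  have hsplit : timeOrderedExp H = fun s => 1 + ∑' n, dyson H (n + 1) s :=
    funext fun s => (summable_dyson hM s).tsum_eq_zero_add
  have hderiv : ∑' n, (-Complex.I) • (H t * dyson H n t)
      = (-Complex.I) • (H t * timeOrderedExp H t) := by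
    rw [tsum_const_smul'', timeOrderedExp, (summable_dyson hM t).tsum_mul_left]
  rw [← hderiv, hsplit]
  exact (hasDerivAt_tsum_dyson_succ hH hM t).const_add 1

lemma hasDerivWithinAt_timeOrderedExp (hT : 0 ≤ T) (hH : ContinuousOn H (Icc 0 T)) {t : ℝ}
    (ht : t ∈ Icc 0 T) :
    HasDerivWithinAt (timeOrderedExp H) ((-Complex.I) • (H t * timeOrderedExp H t))
      (Icc 0 T) t := by
  obtain ⟨M, hM⟩ := isCompact_Icc.exists_bound_of_continuousOn hH
  set K : ℝ → 𝓗 →L[ℂ] 𝓗 := IccExtend hT ((Icc 0 T).domRestrict H)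
  have hHK : EqOn H K (Icc 0 T) := fun s hs =>
    (IccExtend_of_mem hT ((Icc 0 T).domRestrict H) hs).symm
  have hK : Continuous K := (continuousOn_iff_continuous_domRestrict.1 hH).Icc_extend'
  have hKM : ∀ s, ‖K s‖ ≤ M := fun s => hM _ (projIcc 0 T hT s).2
  rw [hHK ht, timeOrderedExp_congr hHK ht]
  exact (hasDerivAt_timeOrderedExp hK hKM t).hasDerivWithinAt.congr
    (timeOrderedExp_congr hHK) (timeOrderedExp_congr hHK ht)

lemma star_timeOrderedExp_mul_self (hT : 0 ≤ T) (hH : ContinuousOn H (Icc 0 T))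
    (hsa : ∀ t ∈ Icc 0 T, IsSelfAdjoint (H t)) {t : ℝ} (ht : t ∈ Icc 0 T) :
    star (timeOrderedExp H t) * timeOrderedExp H t = 1 := by
  have hderiv : ∀ s ∈ Icc 0 T, HasDerivWithinAt
      (fun s => star (timeOrderedExp H s) * timeOrderedExp H s) 0 (Icc 0 T) s := by
    intro s hs
    have hU := hasDerivWithinAt_timeOrderedExp hT hH hs
    refine (hU.star.mul hU).congr_deriv ?_
    simp [(hsa s hs).star_eq, mul_assoc]
  have hconst := (convex_Icc 0 T).norm_image_sub_le_of_norm_hasDerivWithin_le (C := 0) hderiv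
    (by simp) (left_mem_Icc.2 hT) ht
  simpa [timeOrderedExp_zero, sub_eq_zero] using hconst

/- In infinite dimension `U† U = 1` does not give `U U† = 1`. The defect `Z = U U† - 1` solves the
linear equation `Z' = -i [H, Z]` with `Z(0) = 0`. -/
lemma timeOrderedExp_mul_star_self (hT : 0 ≤ T) (hH : ContinuousOn H (Icc 0 T))
    (hsa : ∀ t ∈ Icc 0 T, IsSelfAdjoint (H t)) {t : ℝ} (ht : t ∈ Icc 0 T) :
    timeOrderedExp H t * star (timeOrderedExp H t) = 1 := by
  obtain ⟨M, hM⟩ := isCompact_Icc.exists_bound_of_continuousOn hH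
  set Z : ℝ → 𝓗 →L[ℂ] 𝓗 := fun s => timeOrderedExp H s * star (timeOrderedExp H s) - 1
  have hZ : ∀ s ∈ Icc 0 T, HasDerivWithinAt Z
      ((-Complex.I) • (H s * Z s - Z s * H s)) (Icc 0 T) s := by
    intro s hs
    have hU := hasDerivWithinAt_timeOrderedExp hT hH hs
    refine ((hU.mul hU.star).sub_const 1).congr_deriv ?_
    simp [(hsa s hs).star_eq, mul_assoc, Z, mul_sub, sub_mul]
    module
  refine sub_eq_zero.1 (eq_zero_of_abs_deriv_le_mul_abs_self_of_eq_zero_right (K := 2 * M)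
    (fun s hs => (hZ s hs).continuousWithinAt)
    (fun s hs => (hZ s (Ico_subset_Icc_self hs)).mono_of_mem_nhdsWithin
      (Icc_mem_nhdsGE_of_mem hs)) (by simp [Z, timeOrderedExp_zero]) (fun s hs => ?_) t ht)
  have hMs := hM s (Ico_subset_Icc_self hs)
  calc ‖(-Complex.I) • (H s * Z s - Z s * H s)‖ = ‖H s * Z s - Z s * H s‖ := by simp [norm_smul]
    _ ≤ M * ‖Z s‖ + ‖Z s‖ * M :=
        norm_sub_le_of_le (norm_mul_le_of_le hMs le_rfl) (norm_mul_le_of_le le_rfl hMs)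
    _ = 2 * M * ‖Z s‖ := by ring

lemma timeOrderedExp_mem_unitary (hT : 0 ≤ T) (hH : ContinuousOn H (Icc 0 T))
    (hsa : ∀ t ∈ Icc 0 T, IsSelfAdjoint (H t)) {t : ℝ} (ht : t ∈ Icc 0 T) :
    timeOrderedExp H t ∈ unitary (𝓗 →L[ℂ] 𝓗) :=
  ⟨star_timeOrderedExp_mul_self hT hH hsa ht, timeOrderedExp_mul_star_self hT hH hsa ht⟩

-- `star V * C * U` moves only as fast as `C` fails to intertwine the two evolutions.
theorem norm_timeOrderedExp_sub_le_of_intertwiner (hT : 0 ≤ T)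
    (hH : ContinuousOn H (Icc 0 T)) (hK : ContinuousOn K (Icc 0 T))
    (hHsa : ∀ t ∈ Icc 0 T, IsSelfAdjoint (H t)) (hKsa : ∀ t ∈ Icc 0 T, IsSelfAdjoint (K t))
    {C C' : ℝ → 𝓗 →L[ℂ] 𝓗} (hC : ∀ t ∈ Icc 0 T, HasDerivWithinAt C (C' t) (Icc 0 T) t) {y q : ℝ}
    (hy : ∀ t ∈ Icc 0 T, ‖C t - 1‖ ≤ y)
    (hq : ∀ t ∈ Icc 0 T, ‖Complex.I • (K t * C t - C t * H t) + C' t‖ ≤ q)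
    {t : ℝ} (ht : t ∈ Icc 0 T) :
    ‖timeOrderedExp H t - timeOrderedExp K t‖ ≤ 2 * y + q * T := by
  set U := timeOrderedExp H with hUdef
  set V := timeOrderedExp K with hVdef
  have h0 : (0 : ℝ) ∈ Icc 0 T := left_mem_Icc.2 hT
  have hU : ∀ s ∈ Icc 0 T, U s ∈ unitary _ := fun s => timeOrderedExp_mem_unitary hT hH hHsa
  have hV : ∀ s ∈ Icc 0 T, V s ∈ unitary _ := fun s => timeOrderedExp_mem_unitary hT hK hKsa
  have hderiv : ∀ s ∈ Icc 0 T, HasDerivWithinAt (fun s => star (V s) * C s * U s)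
      (star (V s) * (Complex.I • (K s * C s - C s * H s) + C' s) * U s) (Icc 0 T) s := by
    intro s hs
    have hV' : HasDerivWithinAt V _ _ s := hasDerivWithinAt_timeOrderedExp hT hK hs
    refine ((hV'.star.mul (hC s hs)).mul (hasDerivWithinAt_timeOrderedExp hT hH hs)).congr_deriv ?_
    simp only [Pi.mul_apply, star_smul, star_mul, star_neg, (hKsa s hs).star_eq,
      Complex.star_def, Complex.conj_I, neg_neg, mul_add, add_mul, smul_mul_assoc,
      mul_smul_comm, mul_sub, sub_mul, mul_assoc, smul_sub, neg_smul, mul_neg]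
    module
  have hincr : ‖star (V t) * C t * U t - C 0‖ ≤ q * T := by
    have hq0 : 0 ≤ q := (norm_nonneg _).trans (hq 0 h0)
    have hmv := (convex_Icc 0 T).norm_image_sub_le_of_norm_hasDerivWithin_le hderiv (fun s hs => by
      rw [CStarRing.norm_mul_mem_unitary _ (hU s hs),
        CStarRing.norm_mem_unitary_mul _ (Unitary.star_mem (hV s hs))]
      exact hq s hs) h0 ht
    simp only [hUdef, hVdef, timeOrderedExp_zero, star_one, one_mul, mul_one, sub_zero] at hmv
    exact hmv.trans (by gcongr; rw [Real.norm_of_nonneg ht.1]; exact ht.2)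
  have hsub : U t - V t
      = V t * (star (V t) * C t * U t - C 0) - (C t - 1) * U t + V t * (C 0 - 1) := by
    have hVV : V t * star (V t) = 1 := Unitary.mul_star_self_of_mem (hV t ht)
    simp only [mul_sub, sub_mul, ← mul_assoc, hVV, one_mul, mul_one]
    abel
  calc ‖U t - V t‖
      ≤ ‖star (V t) * C t * U t - C 0‖ + ‖C t - 1‖ + ‖C 0 - 1‖ := by
        rw [hsub, ← CStarRing.norm_mem_unitary_mul (star (V t) * C t * U t - C 0) (hV t ht),
          ← CStarRing.norm_mul_mem_unitary (C t - 1) (hU t ht),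
          ← CStarRing.norm_mem_unitary_mul (C 0 - 1) (hV t ht)]
        exact norm_add_le_of_le (norm_sub_le _ _) le_rfl
    _ ≤ q * T + y + y := by gcongr; exacts [hy t ht, hy 0 h0]
    _ = 2 * y + q * T := by ring

end Dyson

section Idempotents

variable {ι 𝕜 R : Type*} [Fintype ι] [Ring R] {P : ι → R}

lemma mul_sum_mul_of_orthogonal (hP : OrthogonalIdempotents P) (k : ι) (B : ι → R) :
    P k * ∑ l, P l * B l = P k * B k := by
  classical
  simp [Finset.mul_sum, ← mul_assoc, hP.mul_eq]

lemma sum_mul_mul_of_orthogonal (hP : OrthogonalIdempotents P) (k : ι) (B : ι → R) :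
    (∑ l, B l * P l) * P k = B k * P k := by
  classical
  simp [Finset.sum_mul, mul_assoc, hP.mul_eq]

section Kato

lemma mul_mul_eq_zero_of_mul_add_mul_eq {p d : R} (hp : IsIdempotentElem p)
    (hd : d * p + p * d = d) : p * d * p = 0 := by
  have h := congrArg (p * · * p) hd
  simpa only [mul_add, add_mul, ← mul_assoc, hp.eq, mul_assoc _ p p, add_eq_left] using h

variable {D : ι → R}

lemma sum_deriv_mul_eq_neg (hD : ∀ l, D l * P l + P l * D l = D l) (hD₀ : ∑ l, D l = 0) :
    ∑ l, D l * P l = -∑ l, P l * D l := by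
  rw [eq_neg_iff_add_eq_zero, ← Finset.sum_add_distrib, Finset.sum_congr rfl fun l _ => hD l, hD₀]

/- With `D = Ṗ` the two hypotheses on `D` are the derivatives of `Pₗ² = Pₗ` and `∑ₗ Pₗ = 1`, and
the conclusion says that `∑ₖ Ṗₖ Pₖ` generates the motion of the projections. -/
lemma lie_sum_deriv_mul (hP : OrthogonalIdempotents P) (hD : ∀ l, D l * P l + P l * D l = D l)
    (hD₀ : ∑ l, D l = 0) (l : ι) : ⁅∑ k, D k * P k, P l⁆ = D l := by
  have hleft : P l * ∑ k, D k * P k = -(P l * D l) := by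
    rw [sum_deriv_mul_eq_neg hD hD₀, mul_neg, mul_sum_mul_of_orthogonal hP]
  rw [Ring.lie_def, sum_mul_mul_of_orthogonal hP, hleft, sub_neg_eq_add, hD]

lemma mul_sum_deriv_mul_mul_eq_zero (hP : OrthogonalIdempotents P)
    (hD : ∀ l, D l * P l + P l * D l = D l) (l : ι) : P l * (∑ k, D k * P k) * P l = 0 := by
  rw [mul_assoc, sum_mul_mul_of_orthogonal hP, ← mul_assoc,
    mul_mul_eq_zero_of_mul_add_mul_eq (hP.idem l) (hD l)]

end Kato

variable [Field 𝕜] [Algebra 𝕜 R]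

/-- The Schur multiplier `X ↦ ∑ₖₗ wₖₗ Pₖ X Pₗ`, which rescales the blocks of `X` with respect to the
family `P` by the weights `w`. -/
def schurMultiplier (P : ι → R) (w : ι → ι → 𝕜) (X : R) : R :=
  ∑ k, ∑ l, w k l • (P k * X * P l)

lemma sum_smul_mul_of_orthogonal (hP : OrthogonalIdempotents P) (e : ι → 𝕜) (k : ι) :
    (∑ l, e l • P l) * P k = e k • P k := by
  classical
  simp [Finset.sum_mul, hP.mul_eq]

lemma mul_sum_smul_of_orthogonal (hP : OrthogonalIdempotents P) (e : ι → 𝕜) (k : ι) :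
    P k * ∑ l, e l • P l = e k • P k := by
  classical
  simp [Finset.mul_sum, hP.mul_eq]

lemma lie_block (hP : OrthogonalIdempotents P) (e : ι → 𝕜) (X : R) (k l : ι) :
    ⁅∑ j, e j • P j, P k * X * P l⁆ = (e k - e l) • (P k * X * P l) := by
  rw [Ring.lie_def, mul_assoc (P k), ← mul_assoc _ (P k), sum_smul_mul_of_orthogonal hP,
    mul_assoc, mul_assoc, mul_sum_smul_of_orthogonal hP, smul_mul_assoc, mul_smul_comm,
    mul_smul_comm, sub_smul]

lemma sum_mul_mul_eq_of_subsingleton [Subsingleton ι] (hP : ∑ l, P l = 1) (X : R) :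
    ∑ l, P l * X * P l = X := by
  calc ∑ l, P l * X * P l = ∑ k, ∑ l, P k * X * P l :=
        Finset.sum_congr rfl fun k _ => (Fintype.sum_subsingleton (P k * X * P ·) k).symm
    _ = X := by simp only [← Finset.mul_sum, ← Finset.sum_mul, hP, one_mul, mul_one]

lemma lie_schurMultiplier (hP : OrthogonalIdempotents P) (e : ι → 𝕜) (w : ι → ι → 𝕜) (X : R) :
    ⁅∑ l, e l • P l, schurMultiplier P w X⁆
      = schurMultiplier P (fun k l => w k l * (e k - e l)) X := by
  have hblock := lie_block hP e X
  generalize ∑ l, e l • P l = H at hblock ⊢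
  simp only [Ring.lie_def] at hblock ⊢
  simp only [schurMultiplier, Finset.mul_sum, Finset.sum_mul, ← Finset.sum_sub_distrib,
    mul_smul_comm, smul_mul_assoc, ← smul_sub, hblock, smul_smul]

-- The junk value `0⁻¹ = 0` removes the diagonal blocks.
lemma lie_schurMultiplier_inv (hP : CompleteOrthogonalIdempotents P) {e : ι → 𝕜}
    (he : Function.Injective e) (X : R) :
    ⁅∑ l, e l • P l, schurMultiplier P (fun k l => (e k - e l)⁻¹) X⁆ = X - ∑ l, P l * X * P l := by
  classical
  have hweight (k l : ι) : (e k - e l)⁻¹ * (e k - e l) = if k = l then 0 else 1 := by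
    split_ifs with hkl
    · simp [hkl]
    · exact inv_mul_cancel₀ (sub_ne_zero.2 (he.ne hkl))
  have hblocks : ∑ k, ∑ l, P k * X * P l = X := by
    simp only [← Finset.mul_sum, ← Finset.sum_mul, hP.complete, one_mul, mul_one]
  have hdiag (k : ι) : P k * X * P k = ∑ l, if k = l then P k * X * P l else 0 := by simp
  rw [lie_schurMultiplier hP.toOrthogonalIdempotents, Finset.sum_congr rfl fun k _ => hdiag k]
  conv_rhs => enter [1]; rw [← hblocks]
  simp only [schurMultiplier, hweight, ← Finset.sum_sub_distrib]
  refine Finset.sum_congr rfl fun k _ => Finset.sum_congr rfl fun l _ => ?_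
  split_ifs <;> simp

end Idempotents

section DerivSchurMultiplier

variable {ι 𝕜 𝕜' R : Type*} [Fintype ι] [NontriviallyNormedField 𝕜] [NormedField 𝕜']
  [NormedAlgebra 𝕜 𝕜'] [NormedRing R] [NormedAlgebra 𝕜 R] [NormedAlgebra 𝕜' R]
  [IsScalarTower 𝕜 𝕜' R] {P : ι → 𝕜 → R} {w : ι → ι → 𝕜 → 𝕜'} {w' : ι → ι → 𝕜'} {X : 𝕜 → R}
  {B X' : R} {s : Set 𝕜} {t : 𝕜}

lemma hasDerivWithinAt_schurMultiplier
    (hP : ∀ l, HasDerivWithinAt (P l) ⁅B, P l t⁆ s t)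
    (hw : ∀ k l, HasDerivWithinAt (w k l) (w' k l) s t) (hX : HasDerivWithinAt X X' s t) :
    HasDerivWithinAt (fun r => schurMultiplier (P · r) (w · · r) (X r))
      (⁅B, schurMultiplier (P · t) (w · · t) (X t)⁆
        + (schurMultiplier (P · t) (w · · t) (X' - ⁅B, X t⁆)
          + schurMultiplier (P · t) w' (X t))) s t := by
  refine (HasDerivWithinAt.fun_sum fun k _ => .fun_sum fun l _ =>
    (hw k l).smul (((hP k).mul hX).mul (hP l))).congr_deriv ?_
  simp only [schurMultiplier, Ring.lie_def, Finset.mul_sum, Finset.sum_mul,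
    ← Finset.sum_sub_distrib, ← Finset.sum_add_distrib]
  refine Finset.sum_congr rfl fun k _ => Finset.sum_congr rfl fun l _ => ?_
  simp only [Pi.mul_apply, mul_sub, sub_mul, add_mul, mul_smul_comm,
    smul_mul_assoc, smul_sub, smul_add, mul_assoc]
  abel

end DerivSchurMultiplier

section Residual

variable {R : Type*} [Ring R] [Algebra ℂ R] {κ : ℝ} {H₀ G Z A Y Y' W : R}

lemma residual_eq (hκ : κ ≠ 0) (hY : ⁅H₀, Y⁆ = G - A - Z)
    (hY' : Y' = ⁅(-Complex.I) • A, Y⁆ + W) :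
    Complex.I • (((κ : ℂ) • H₀ + Z + A) * (1 + (κ : ℂ)⁻¹ • Y)
        - (1 + (κ : ℂ)⁻¹ • Y) * ((κ : ℂ) • H₀ + G)) + (κ : ℂ)⁻¹ • Y'
      = (κ : ℂ)⁻¹ • (Complex.I • (Z * Y - Y * (G - A)) + W) := by
  have hκ' : (κ : ℂ) ≠ 0 := Complex.ofReal_ne_zero.2 hκ
  have hYH : Y * H₀ = H₀ * Y - (G - A - Z) := by rw [← hY, Ring.lie_def, sub_sub_cancel]
  simp only [hY', Ring.lie_def, mul_add, add_mul, mul_one, one_mul, mul_sub, smul_mul_assoc,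
    mul_smul_comm, smul_add, smul_sub, smul_smul, hYH, mul_inv_cancel₀ hκ', inv_mul_cancel₀ hκ']
  match_scalars <;> field_simp <;> ring

end Residual

section Resolution

variable {ι 𝕜 𝓗 : Type*} [Fintype ι] [RCLike 𝕜] [NormedAddCommGroup 𝓗] [InnerProductSpace 𝕜 𝓗]
  [CompleteSpace 𝓗]

/-- A finite orthogonal resolution of the identity on a Hilbert space: complete orthogonal
idempotents that are self-adjoint. -/
structure IsResolution (P : ι → 𝓗 →L[𝕜] 𝓗) : Prop extends CompleteOrthogonalIdempotents P where
  selfAdjoint : ∀ l, IsSelfAdjoint (P l)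

namespace IsResolution

variable {P : ι → 𝓗 →L[𝕜] 𝓗} (hP : IsResolution P)
include hP

lemma norm_le_one (l : ι) : ‖P l‖ ≤ 1 := IsStarProjection.norm_le _ ⟨hP.idem l, hP.selfAdjoint l⟩

lemma sum_norm_sq (x : 𝓗) : ∑ l, ‖P l x‖ ^ 2 = ‖x‖ ^ 2 := by
  have hinner (l : ι) : ‖P l x‖ ^ 2 = RCLike.re (inner 𝕜 x (P l x)) := by
    rw [ContinuousLinearMap.apply_norm_sq_eq_inner_adjoint_right,
      ← ContinuousLinearMap.star_eq_adjoint, (hP.selfAdjoint l).star_eq]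
    exact congrArg (fun B : 𝓗 →L[𝕜] 𝓗 => RCLike.re (inner 𝕜 x (B x))) (hP.idem l)
  simp only [hinner, ← map_sum, ← inner_sum, ← sum_apply, hP.complete,
    one_apply_eq_self, inner_self_eq_norm_sq]

lemma norm_le_of_row_apply_le {S : 𝓗 →L[𝕜] 𝓗} {c : ℝ} (hc : 0 ≤ c)
    (h : ∀ k x, ‖P k (S x)‖ ≤ c * ‖P k x‖) : ‖S‖ ≤ c := by
  refine S.opNorm_le_bound hc fun x => (sq_le_sq₀ (norm_nonneg _) (by positivity)).1 ?_
  rw [mul_pow, ← hP.sum_norm_sq (S x), ← hP.sum_norm_sq x, Finset.mul_sum]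
  exact Finset.sum_le_sum fun k _ => by rw [← mul_pow]; gcongr; exact h k x

lemma norm_le_sqrt_card_mul {S : 𝓗 →L[𝕜] 𝓗} {c : ℝ} (hc : 0 ≤ c) (h : ∀ k, ‖P k * S‖ ≤ c) :
    ‖S‖ ≤ √(Fintype.card ι) * c := by
  refine S.opNorm_le_bound (by positivity) fun x => (sq_le_sq₀ (norm_nonneg _) (by positivity)).1 ?_
  rw [← hP.sum_norm_sq]
  calc ∑ k, ‖P k (S x)‖ ^ 2 ≤ ∑ _k : ι, (c * ‖x‖) ^ 2 := by
        gcongr with k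
        exact (P k * S).le_of_opNorm_le (h k) x
    _ = (√(Fintype.card ι) * c * ‖x‖) ^ 2 := by
        rw [mul_assoc, mul_pow √_, Real.sq_sqrt (Nat.cast_nonneg _), Finset.sum_const,
          Finset.card_univ, nsmul_eq_mul]

lemma norm_sum_mul_mul_le (G : 𝓗 →L[𝕜] 𝓗) : ‖∑ l, P l * G * P l‖ ≤ ‖G‖ := by
  refine hP.norm_le_of_row_apply_le (norm_nonneg G) fun k x => ?_
  have hrow : P k * ∑ l, P l * G * P l = P k * (G * P k) := by
    simp only [mul_assoc, mul_sum_mul_of_orthogonal hP.toOrthogonalIdempotents k fun l => G * P l]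
  calc ‖P k ((∑ l, P l * G * P l) x)‖ = ‖P k (G (P k x))‖ :=
        congrArg (fun B : 𝓗 →L[𝕜] 𝓗 => ‖B x‖) hrow
    _ ≤ 1 * ‖G (P k x)‖ := (P k).le_of_opNorm_le (hP.norm_le_one k) _
    _ ≤ ‖G‖ * ‖P k x‖ := by rw [one_mul]; exact G.le_opNorm _

lemma norm_sum_smul_le {w : ι → 𝕜} {c : ℝ} (hc : 0 ≤ c) (h : ∀ l, ‖w l‖ ≤ c) :
    ‖∑ l, w l • P l‖ ≤ c := by
  refine hP.norm_le_of_row_apply_le hc fun k x => ?_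
  have hrow := mul_sum_smul_of_orthogonal hP.toOrthogonalIdempotents w k
  calc ‖P k ((∑ l, w l • P l) x)‖ = ‖w k • P k x‖ :=
        congrArg (fun B : 𝓗 →L[𝕜] 𝓗 => ‖B x‖) hrow
    _ ≤ c * ‖P k x‖ := by rw [norm_smul]; gcongr; exact h k

-- Row by row the multiplier is `Pₖ X` times a diagonal operator of norm at most `c`.
lemma norm_schurMultiplier_le {w : ι → ι → 𝕜} {c : ℝ} (hc : 0 ≤ c) (h : ∀ k l, ‖w k l‖ ≤ c)
    (X : 𝓗 →L[𝕜] 𝓗) : ‖schurMultiplier P w X‖ ≤ √(Fintype.card ι) * c * ‖X‖ := by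
  have hrow (k : ι) : P k * schurMultiplier P w X = P k * X * ∑ l, w k l • P l := by
    have hsum : schurMultiplier P w X = ∑ k, P k * (X * ∑ l, w k l • P l) := by
      simp only [schurMultiplier, Finset.mul_sum, mul_smul_comm, mul_assoc]
    rw [hsum, mul_sum_mul_of_orthogonal hP.toOrthogonalIdempotents, mul_assoc]
  rw [mul_assoc]
  refine hP.norm_le_sqrt_card_mul (by positivity) fun k => ?_
  calc ‖P k * schurMultiplier P w X‖ ≤ 1 * ‖X‖ * c := by
        rw [hrow]
        exact norm_mul_le_of_le (norm_mul_le_of_le (hP.norm_le_one k) le_rfl)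
          (hP.norm_sum_smul_le hc (h k))
    _ = c * ‖X‖ := by ring

end IsResolution

end Resolution

section Adiabatic

variable {𝓗 : Type*} [NormedAddCommGroup 𝓗] [InnerProductSpace ℂ 𝓗] [CompleteSpace 𝓗]
  {m : ℕ} {T : ℝ} {H₀ : ℝ → 𝓗 →L[ℂ] 𝓗} {E : Fin m → ℝ → ℝ} {P : Fin m → ℝ → 𝓗 →L[ℂ] 𝓗}
  {G : ℝ → 𝓗 →L[ℂ] 𝓗} {t : ℝ}

/-- The first-order corrector `Y = ∑ₖₗ (Eₖ - Eₗ)⁻¹ Pₖ (G - A) Pₗ`. It is chosen such that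
`1 + κ⁻¹ Y` intertwines the generators `κ H₀ + G` and `κ H₀ + G_Z + A` up to `O(κ⁻¹)`. -/
noncomputable def corrector (T : ℝ) (E : Fin m → ℝ → ℝ) (P : Fin m → ℝ → 𝓗 →L[ℂ] 𝓗)
    (G : ℝ → 𝓗 →L[ℂ] 𝓗) (t : ℝ) : 𝓗 →L[ℂ] 𝓗 :=
  schurMultiplier (P · t) (fun k l => ((E k t : ℂ) - E l t)⁻¹) (G t - connection T P t)

namespace IsAdiabatic

variable (h : IsAdiabatic T H₀ E P)
include h

lemma isResolution (ht : t ∈ Icc 0 T) : IsResolution (P · t) where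
  idem l := (h.orthogonal l l t ht).trans (if_pos rfl)
  ortho k l hkl := (h.orthogonal k l t ht).trans (if_neg hkl)
  complete := h.complete t ht
  selfAdjoint l := h.selfAdjoint l t ht

lemma isSelfAdjoint_hamiltonian (ht : t ∈ Icc 0 T) : IsSelfAdjoint (H₀ t) := by
  rw [h.spectral t ht]
  exact isSelfAdjoint_sum _ fun l _ =>
    IsSelfAdjoint.smul (Complex.conj_ofReal (E l t)) (h.selfAdjoint l t ht)

lemma continuousOn_hamiltonian : ContinuousOn H₀ (Icc 0 T) := by
  refine ContinuousOn.congr (continuousOn_finsetSum _ fun l _ => ?_) h.spectral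
  exact (Complex.continuous_ofReal.comp_continuousOn (h.contDiff_E l).continuousOn).smul
    (h.contDiff_P l).continuousOn

lemma isSelfAdjoint_zeno (ht : t ∈ Icc 0 T) (hG : IsSelfAdjoint (G t)) :
    IsSelfAdjoint (zeno P G t) :=
  isSelfAdjoint_sum _ fun l _ => by
    simpa only [(h.selfAdjoint l t ht).star_eq] using hG.conjugate (P l t)

lemma continuousOn_zeno (hG : ContinuousOn G (Icc 0 T)) : ContinuousOn (zeno P G) (Icc 0 T) :=
  continuousOn_finsetSum _ fun l _ =>
    ((h.contDiff_P l).continuousOn.mul hG).mul (h.contDiff_P l).continuousOn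

lemma hasDerivWithinAt_proj (ht : t ∈ Icc 0 T) (l : Fin m) :
    HasDerivWithinAt (P l) (timeDeriv T (P l) t) (Icc 0 T) t :=
  ((h.contDiff_P l).differentiableOn (by norm_num) t ht).hasDerivWithinAt

variable (hT : 0 < T)
include hT

lemma timeDeriv_proj_mul_add_mul (ht : t ∈ Icc 0 T) (l : Fin m) :
    timeDeriv T (P l) t * P l t + P l t * timeDeriv T (P l) t = timeDeriv T (P l) t := by
  have hd := h.hasDerivWithinAt_proj ht l
  exact (uniqueDiffOn_Icc hT t ht).eq_deriv _ (hd.mul hd)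
    (hd.congr (fun s hs => (h.isResolution hs).idem l) ((h.isResolution ht).idem l))

lemma sum_timeDeriv_proj (ht : t ∈ Icc 0 T) : ∑ l, timeDeriv T (P l) t = 0 :=
  (uniqueDiffOn_Icc hT t ht).eq_deriv _
    (HasDerivWithinAt.fun_sum fun l _ => h.hasDerivWithinAt_proj ht l)
    ((hasDerivWithinAt_const t (Icc 0 T) (1 : 𝓗 →L[ℂ] 𝓗)).congr h.complete (h.complete t ht))

lemma isSelfAdjoint_timeDeriv_proj (ht : t ∈ Icc 0 T) (l : Fin m) :
    IsSelfAdjoint (timeDeriv T (P l) t) := by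
  have hd := h.hasDerivWithinAt_proj ht l
  exact (uniqueDiffOn_Icc hT t ht).eq_deriv _ hd.star
    (hd.congr (h.selfAdjoint l) (h.selfAdjoint l t ht))

lemma connection_eq (ht : t ∈ Icc 0 T) :
    connection T P t = Complex.I • ∑ l, timeDeriv T (P l) t * P l t := by
  have hsum := sum_deriv_mul_eq_neg (P := (P · t)) (h.timeDeriv_proj_mul_add_mul hT ht)
    (h.sum_timeDeriv_proj hT ht)
  rw [connection, ← Finset.smul_sum, Finset.sum_sub_distrib, ← neg_eq_iff_eq_neg.2 hsum]
  module

lemma isSelfAdjoint_connection (ht : t ∈ Icc 0 T) : IsSelfAdjoint (connection T P t) := by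
  refine isSelfAdjoint_sum _ fun l _ => ?_
  have hstar : star (timeDeriv T (P l) t * P l t - P l t * timeDeriv T (P l) t)
      = -(timeDeriv T (P l) t * P l t - P l t * timeDeriv T (P l) t) := by
    simp only [star_sub, star_mul, (h.isSelfAdjoint_timeDeriv_proj hT ht l).star_eq,
      (h.selfAdjoint l t ht).star_eq, neg_sub]
  rw [IsSelfAdjoint, star_smul, hstar, smul_neg, ← neg_smul]
  simp [neg_div]

lemma contDiffOn_connection : ContDiffOn ℝ 1 (connection T P) (Icc 0 T) := by
  refine ContDiffOn.sum fun l _ => ?_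
  have hP : ContDiffOn ℝ 1 (P l) (Icc 0 T) := (h.contDiff_P l).of_le (by norm_num)
  have hP' : ContDiffOn ℝ 1 (timeDeriv T (P l)) (Icc 0 T) :=
    (h.contDiff_P l).derivWithin (uniqueDiffOn_Icc hT) (by norm_num)
  exact ((hP'.mul hP).sub (hP.mul hP')).const_smul (Complex.I / 2)

lemma hasDerivWithinAt_connection (ht : t ∈ Icc 0 T) :
    HasDerivWithinAt (connection T P) (timeDeriv T (connection T P) t) (Icc 0 T) t :=
  ((h.contDiffOn_connection hT).differentiableOn one_ne_zero t ht).hasDerivWithinAt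

lemma lie_connection_proj (ht : t ∈ Icc 0 T) (l : Fin m) :
    ⁅(-Complex.I) • connection T P t, P l t⁆ = timeDeriv T (P l) t := by
  rw [h.connection_eq hT ht, smul_smul, neg_mul, Complex.I_mul_I, neg_neg, one_smul]
  exact lie_sum_deriv_mul (P := (P · t)) (h.isResolution ht).toOrthogonalIdempotents
    (h.timeDeriv_proj_mul_add_mul hT ht) (h.sum_timeDeriv_proj hT ht) l

lemma proj_mul_connection_mul_proj (ht : t ∈ Icc 0 T) (l : Fin m) :
    P l t * connection T P t * P l t = 0 := by
  have hdiag := mul_sum_deriv_mul_mul_eq_zero (P := (P · t))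
    (h.isResolution ht).toOrthogonalIdempotents (h.timeDeriv_proj_mul_add_mul hT ht) l
  rw [h.connection_eq hT ht, mul_smul_comm, smul_mul_assoc, hdiag, smul_zero]

lemma lie_hamiltonian_corrector (ht : t ∈ Icc 0 T) :
    ⁅H₀ t, corrector T E P G t⁆ = G t - connection T P t - zeno P G t := by
  have hinj : Function.Injective fun l => (E l t : ℂ) := fun k l hkl => by
    by_contra hne
    exact (abs_pos.1 (h.noCrossing k l hne t ht)) (sub_eq_zero.2 (Complex.ofReal_injective hkl))
  rw [h.spectral t ht, corrector,
    lie_schurMultiplier_inv (h.isResolution ht).toCompleteOrthogonalIdempotents hinj]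
  simp only [mul_sub, sub_mul, h.proj_mul_connection_mul_proj hT ht, sub_zero, zeno]

omit hT

lemma hasDerivWithinAt_inv_gap (ht : t ∈ Icc 0 T) (k l : Fin m) :
    HasDerivWithinAt (fun s => ((E k s : ℂ) - E l s)⁻¹)
      (-((timeDeriv T (fun s => E k s - E l s) t : ℝ) : ℂ) / ((E k t : ℂ) - E l t) ^ 2)
      (Icc 0 T) t := by
  rcases eq_or_ne k l with rfl | hkl
  · simpa using hasDerivWithinAt_const t (Icc 0 T) (0 : ℂ)
  · have hgap : HasDerivWithinAt (fun s => E k s - E l s) _ (Icc 0 T) t :=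
      (((h.contDiff_E k).sub (h.contDiff_E l)).differentiableOn one_ne_zero t ht).hasDerivWithinAt
    simpa [timeDeriv] using (hgap.fun_inv (abs_pos.1 (h.noCrossing k l hkl t ht))).ofReal_comp

end IsAdiabatic

section Bounds

variable {ι : Type*} {e : ι → ℝ} {v : ι → ι → ℝ} {η η' : ℝ}

lemma norm_inv_gap_le (hη : 0 < η) (hgap : ∀ k l, k ≠ l → η ≤ |e k - e l|) (k l : ι) :
    ‖((e k : ℂ) - e l)⁻¹‖ ≤ η⁻¹ := by
  rcases eq_or_ne k l with rfl | hkl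
  · simpa using hη.le
  · rw [norm_inv, ← Complex.ofReal_sub, Complex.norm_real, Real.norm_eq_abs]
    exact inv_anti₀ hη (hgap k l hkl)

lemma norm_slope_div_gap_sq_le (hη : 0 < η) (hη' : 0 ≤ η')
    (hgap : ∀ k l, k ≠ l → η ≤ |e k - e l|) (hslope : ∀ k l, k ≠ l → |v k l| ≤ η') (k l : ι) :
    ‖-(v k l : ℂ) / ((e k : ℂ) - e l) ^ 2‖ ≤ η' / η ^ 2 := by
  rcases eq_or_ne k l with rfl | hkl
  · simpa using by positivity
  · rw [norm_div, norm_neg, norm_pow, ← Complex.ofReal_sub, Complex.norm_real, Complex.norm_real,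
      Real.norm_eq_abs, Real.norm_eq_abs]
    gcongr
    exacts [hslope k l hkl, hgap k l hkl]

end Bounds

namespace IsAdiabatic

variable {η η' a a' g g' : ℝ}

lemma norm_corrector_le (h : IsAdiabatic T H₀ E P) (hη : 0 < η) (ht : t ∈ Icc 0 T)
    (hgap : ∀ k l, k ≠ l → η ≤ |E k t - E l t|)
    (ha : ‖connection T P t‖ ≤ a) (hg : ‖G t‖ ≤ g) :
    ‖corrector T E P G t‖ ≤ √m / η * (a + g) := by
  calc ‖corrector T E P G t‖ ≤ √(Fintype.card (Fin m)) * η⁻¹ * ‖G t - connection T P t‖ :=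
        (h.isResolution ht).norm_schurMultiplier_le (by positivity)
          (norm_inv_gap_le (e := (E · t)) hη hgap) _
    _ ≤ √m * η⁻¹ * (g + a) := by
        rw [Fintype.card_fin]
        gcongr
        exact norm_sub_le_of_le hg ha
    _ = √m / η * (a + g) := by ring

lemma exists_hasDerivWithinAt_corrector (h : IsAdiabatic T H₀ E P) (hT : 0 < T) (hη : 0 < η)
    (hη' : 0 ≤ η') (ht : t ∈ Icc 0 T) (hgap : ∀ k l, k ≠ l → η ≤ |E k t - E l t|)
    (hslope : ∀ k l, k ≠ l → |timeDeriv T (fun s => E k s - E l s) t| ≤ η')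
    (ha : ‖connection T P t‖ ≤ a) (ha' : ‖timeDeriv T (connection T P) t‖ ≤ a')
    (hG : DifferentiableWithinAt ℝ G (Icc 0 T) t) (hg : ‖G t‖ ≤ g) (hg' : ‖timeDeriv T G t‖ ≤ g') :
    ∃ W, HasDerivWithinAt (corrector T E P G)
        (⁅(-Complex.I) • connection T P t, corrector T E P G t⁆ + W) (Icc 0 T) t ∧
      ‖W‖ ≤ √m / η * (a' + g' + 2 * a * g + η' / η * (a + g)) := by
  have hP (l : Fin m) :
      HasDerivWithinAt (P l) ⁅(-Complex.I) • connection T P t, P l t⁆ (Icc 0 T) t := by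
    rw [h.lie_connection_proj hT ht]
    exact h.hasDerivWithinAt_proj ht l
  refine ⟨_, hasDerivWithinAt_schurMultiplier hP (h.hasDerivWithinAt_inv_gap ht)
    (hG.hasDerivWithinAt.sub (h.hasDerivWithinAt_connection hT ht)), ?_⟩
  have hcomm : ⁅(-Complex.I) • connection T P t, (G - connection T P) t⁆
      = (-Complex.I) • (connection T P t * G t - G t * connection T P t) := by
    simp only [Pi.sub_apply, Ring.lie_def, smul_mul_assoc, mul_smul_comm, mul_sub, sub_mul,
      smul_sub]
    abel
  have hX : ‖timeDeriv T G t - timeDeriv T (connection T P) t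
      - ⁅(-Complex.I) • connection T P t, (G - connection T P) t⁆‖ ≤ g' + a' + (a * g + g * a) := by
    refine norm_sub_le_of_le (norm_sub_le_of_le hg' ha') ?_
    rw [hcomm, norm_smul, norm_neg, Complex.norm_I, one_mul]
    exact norm_sub_le_of_le (norm_mul_le_of_le ha hg) (norm_mul_le_of_le hg ha)
  have hres := h.isResolution ht
  refine (norm_add_le_of_le
    (hres.norm_schurMultiplier_le (by positivity) (norm_inv_gap_le (e := (E · t)) hη hgap) _)
    (hres.norm_schurMultiplier_le (by positivity)
      (norm_slope_div_gap_sq_le (e := (E · t)) hη hη' hgap hslope) _)).trans ?_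
  rw [Fintype.card_fin]
  calc √m * η⁻¹ * _ + √m * (η' / η ^ 2) * _
      ≤ √m * η⁻¹ * (g' + a' + (a * g + g * a)) + √m * (η' / η ^ 2) * (g + a) := by
        gcongr
        exacts [hX, norm_sub_le_of_le hg ha]
    _ = √m / η * (a' + g' + 2 * a * g + η' / η * (a + g)) := by field_simp; ring

lemma norm_residual_le (h : IsAdiabatic T H₀ E P) (hT : 0 < T) {κ : ℝ} (hκ : 0 < κ) {w y : ℝ}
    (ht : t ∈ Icc 0 T) (ha : ‖connection T P t‖ ≤ a) (hg : ‖G t‖ ≤ g) {Y' W : 𝓗 →L[ℂ] 𝓗}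
    (hY : ‖corrector T E P G t‖ ≤ y)
    (hY' : Y' = ⁅(-Complex.I) • connection T P t, corrector T E P G t⁆ + W) (hW : ‖W‖ ≤ w) :
    ‖Complex.I • (((κ : ℂ) • H₀ t + zeno P G t + connection T P t)
          * (1 + (κ : ℂ)⁻¹ • corrector T E P G t)
        - (1 + (κ : ℂ)⁻¹ • corrector T E P G t) * ((κ : ℂ) • H₀ t + G t)) + (κ : ℂ)⁻¹ • Y'‖
      ≤ κ⁻¹ * ((a + 2 * g) * y + w) := by
  have hZ : ‖zeno P G t‖ ≤ g := ((h.isResolution ht).norm_sum_mul_mul_le (G t)).trans hg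
  have hcomm : ‖Complex.I • (zeno P G t * corrector T E P G t
      - corrector T E P G t * (G t - connection T P t))‖ ≤ g * y + y * (g + a) := by
    rw [norm_smul, Complex.norm_I, one_mul]
    exact norm_sub_le_of_le (norm_mul_le_of_le hZ hY)
      (norm_mul_le_of_le hY (norm_sub_le_of_le hg ha))
  rw [residual_eq hκ.ne' (h.lie_hamiltonian_corrector hT ht) hY', norm_smul, norm_inv,
    Complex.norm_of_nonneg hκ.le]
  gcongr
  linarith [norm_add_le_of_le hcomm hW]

theorem norm_evolution_sub_le (h : IsAdiabatic T H₀ E P) (hT : 0 < T)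
    (hGsa : ∀ t ∈ Icc 0 T, IsSelfAdjoint (G t)) (hGd : DifferentiableOn ℝ G (Icc 0 T))
    {κ : ℝ} (hκ : 0 < κ) (hη : 0 < η) (hη' : 0 ≤ η')
    (hgap : ∀ k l, k ≠ l → ∀ t ∈ Icc 0 T, η ≤ |E k t - E l t|)
    (hslope : ∀ k l, k ≠ l → ∀ t ∈ Icc 0 T, |timeDeriv T (fun s => E k s - E l s) t| ≤ η')
    (ha : ∀ t ∈ Icc 0 T, ‖connection T P t‖ ≤ a)
    (ha' : ∀ t ∈ Icc 0 T, ‖timeDeriv T (connection T P) t‖ ≤ a')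
    (hg : ∀ t ∈ Icc 0 T, ‖G t‖ ≤ g) (hg' : ∀ t ∈ Icc 0 T, ‖timeDeriv T G t‖ ≤ g')
    (ht : t ∈ Icc 0 T) :
    ‖timeOrderedExp (fun s => (κ : ℂ) • H₀ s + G s) t - adiabaticEvolution T H₀ P G κ t‖
      ≤ √m / (κ * η) * (1 + T * a + 2 * T * g)
        * ((2 + η' / η * T) * (a + g) + T * (a' + g' + 2 * a * g)) := by
  have hκH₀ : ContinuousOn (fun s => (κ : ℂ) • H₀ s) (Icc 0 T) :=
    h.continuousOn_hamiltonian.fun_const_smul _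
  have hκH₀sa (s) (hs : s ∈ Icc 0 T) : IsSelfAdjoint ((κ : ℂ) • H₀ s) :=
    IsSelfAdjoint.smul (Complex.conj_ofReal κ) (h.isSelfAdjoint_hamiltonian hs)
  have hcorr (s) (hs : s ∈ Icc 0 T) : ‖corrector T E P G s‖ ≤ √m / η * (a + g) :=
    h.norm_corrector_le hη hs (fun k l hkl => hgap k l hkl s hs) (ha s hs) (hg s hs)
  choose! W hW hWnorm using fun s (hs : s ∈ Icc 0 T) =>
    h.exists_hasDerivWithinAt_corrector hT hη hη' hs (fun k l hkl => hgap k l hkl s hs)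
      (fun k l hkl => hslope k l hkl s hs) (ha s hs) (ha' s hs) (hGd s hs) (hg s hs) (hg' s hs)
  have hdist := norm_timeOrderedExp_sub_le_of_intertwiner hT.le (hκH₀.add hGd.continuousOn)
    ((hκH₀.add (h.continuousOn_zeno hGd.continuousOn)).add
      (h.contDiffOn_connection hT).continuousOn)
    (fun s hs => (hκH₀sa s hs).add (hGsa s hs))
    (fun s hs => ((hκH₀sa s hs).add (h.isSelfAdjoint_zeno hs (hGsa s hs))).add
      (h.isSelfAdjoint_connection hT hs))
    (fun s hs => ((hW s hs).const_smul (κ : ℂ)⁻¹).const_add 1) (y := κ⁻¹ * (√m / η * (a + g)))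
    (fun s hs => by
      simpa [norm_smul, abs_of_pos hκ] using
        mul_le_mul_of_nonneg_left (hcorr s hs) (inv_nonneg.2 hκ.le))
    (fun s hs => h.norm_residual_le hT hκ hs (ha s hs) (hg s hs) (hcorr s hs) rfl (hWnorm s hs)) ht
  have ha₀ := (norm_nonneg _).trans (ha t ht)
  have ha₀' := (norm_nonneg _).trans (ha' t ht)
  have hg₀ := (norm_nonneg _).trans (hg t ht)
  have hg₀' := (norm_nonneg _).trans (hg' t ht)
  have hslack : 0 ≤ T * (a + 2 * g)
      * ((1 + η' / η * T) * (a + g) + T * (a' + g' + 2 * a * g)) := by positivity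
  calc _ ≤ _ := hdist
    _ = √m / (κ * η) * ((2 + T * (a + 2 * g) + η' / η * T) * (a + g)
          + T * (a' + g' + 2 * a * g)) := by field_simp; ring
    _ ≤ _ := by
      rw [mul_assoc (√m / (κ * η))]
      refine mul_le_mul_of_nonneg_left ?_ (by positivity)
      linear_combination hslack

end IsAdiabatic

end Adiabatic

section SupNorm

variable {X : Type*} [NormedAddCommGroup X] {T : ℝ} {F : ℝ → X}

lemma enorm_le_supNorm {t : ℝ} (ht : t ∈ Icc 0 T) : ‖F t‖ₑ ≤ supNorm T F :=
  le_iSup₂ (f := fun s (_ : s ∈ Icc 0 T) => ‖F s‖ₑ) t ht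

lemma norm_le_toReal_supNorm (hF : supNorm T F ≠ ⊤) {t : ℝ} (ht : t ∈ Icc 0 T) :
    ‖F t‖ ≤ (supNorm T F).toReal := by
  simpa only [toReal_enorm] using ENNReal.toReal_mono hF (enorm_le_supNorm ht)

lemma supNorm_ne_top (hF : ContinuousOn F (Icc 0 T)) : supNorm T F ≠ ⊤ := by
  obtain ⟨M, hM⟩ := isCompact_Icc.exists_bound_of_continuousOn hF
  refine ne_top_of_le_ne_top ENNReal.ofReal_ne_top (b := ENNReal.ofReal M) (iSup₂_le fun s hs => ?_)
  rw [← ofReal_norm]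
  exact ENNReal.ofReal_le_ofReal (hM s hs)

end SupNorm

section Levels

variable {m : ℕ} {T : ℝ} {E : Fin m → ℝ → ℝ}

lemma minGap_le {k l : Fin m} (hkl : k ≠ l) {t : ℝ} (ht : t ∈ Icc 0 T) :
    minGap T E ≤ ‖E k t - E l t‖ₑ :=
  (iInf_le _ k).trans <| (iInf_le _ l).trans <| (iInf_le _ hkl).trans (iInf₂_le t ht)

lemma minGap_ne_top [Nontrivial (Fin m)] (hT : 0 ≤ T) : minGap T E ≠ ⊤ := by
  obtain ⟨k, l, hkl⟩ := exists_pair_ne (Fin m)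
  exact ne_top_of_le_ne_top enorm_ne_top (minGap_le hkl (left_mem_Icc.2 hT))

lemma toReal_minGap_le {k l : Fin m} (hkl : k ≠ l) {t : ℝ} (ht : t ∈ Icc 0 T) :
    (minGap T E).toReal ≤ |E k t - E l t| := by
  simpa only [toReal_enorm, Real.norm_eq_abs] using
    ENNReal.toReal_mono enorm_ne_top (minGap_le hkl ht)

lemma minGap_ne_zero (hE : ∀ l, ContinuousOn (E l) (Icc 0 T))
    (hne : ∀ k l, k ≠ l → ∀ t ∈ Icc 0 T, E k t ≠ E l t) : minGap T E ≠ 0 := by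
  refine iInf_ne_bot fun k => iInf_ne_bot fun l => iInf_ne_bot fun hkl => ?_
  rcases (Icc 0 T).eq_empty_or_nonempty with hempty | hnonempty
  · simp [hempty]
  obtain ⟨s, hs, hmin⟩ :=
    isCompact_Icc.exists_isMinOn hnonempty ((hE k).sub (hE l)).norm
  have hpos : 0 < ‖E k s - E l s‖ₑ := by
    rw [enorm_pos]
    exact sub_ne_zero.2 (hne k l hkl s hs)
  refine (hpos.trans_le (le_iInf₂ fun t ht => ?_)).ne'
  rw [← ofReal_norm, ← ofReal_norm]
  exact ENNReal.ofReal_le_ofReal (hmin ht)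

lemma maxSlope_ne_top (hT : 0 < T) (hE : ∀ l, ContDiffOn ℝ 1 (E l) (Icc 0 T)) :
    maxSlope T E ≠ ⊤ :=
  iSup_ne_top fun k => iSup_ne_top fun l => iSup_ne_top fun _ =>
    supNorm_ne_top (((hE k).sub (hE l)).continuousOn_derivWithin (uniqueDiffOn_Icc hT) le_rfl)

lemma abs_slope_le_toReal_maxSlope (hslope : maxSlope T E ≠ ⊤) {k l : Fin m} (hkl : k ≠ l) {t : ℝ}
    (ht : t ∈ Icc 0 T) : |timeDeriv T (fun s => E k s - E l s) t| ≤ (maxSlope T E).toReal := by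
  have hle : supNorm T (timeDeriv T (fun s => E k s - E l s)) ≤ maxSlope T E :=
    le_iSup_of_le k <| le_iSup_of_le l <| le_iSup_of_le hkl le_rfl
  simpa only [toReal_enorm, Real.norm_eq_abs] using
    ENNReal.toReal_mono hslope ((enorm_le_supNorm ht).trans hle)

end Levels

/-- `f(κ) = o(√κ)` as `κ → +∞`, for a quantity that may take the value `∞`. -/
def IsLittleOSqrt (f : ℝ → ℝ≥0∞) : Prop :=
  Tendsto (fun κ => f κ / ENNReal.ofReal √κ) atTop (𝓝 0)

namespace IsLittleOSqrt

variable {f₁ f₂ : ℝ → ℝ≥0∞} {c : ℝ≥0∞}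

lemma const (hc : c ≠ ⊤) : IsLittleOSqrt fun _ => c := by
  have hsqrt := ENNReal.tendsto_ofReal_atTop.comp Real.tendsto_sqrt_atTop
  have hlim := ENNReal.Tendsto.const_div hsqrt (Or.inr hc)
  rwa [ENNReal.div_top] at hlim

lemma const_mul (hc : c ≠ ⊤) (hf : IsLittleOSqrt f₁) : IsLittleOSqrt fun κ => c * f₁ κ := by
  simpa only [IsLittleOSqrt, mul_div_assoc, mul_zero] using
    ENNReal.Tendsto.const_mul hf (Or.inr hc)

lemma add (hf₁ : IsLittleOSqrt f₁) (hf₂ : IsLittleOSqrt f₂) :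
    IsLittleOSqrt fun κ => f₁ κ + f₂ κ := by
  simpa only [IsLittleOSqrt, ENNReal.add_div, add_zero] using Tendsto.add hf₁ hf₂

lemma tendsto_mul_div (hf₁ : IsLittleOSqrt f₁) (hf₂ : IsLittleOSqrt f₂) :
    Tendsto (fun κ => f₁ κ * f₂ κ / ENNReal.ofReal κ) atTop (𝓝 0) := by
  have hmul := ENNReal.Tendsto.mul hf₁ (Or.inr ENNReal.zero_ne_top) hf₂
    (Or.inr ENNReal.zero_ne_top)
  rw [mul_zero] at hmul
  refine hmul.congr' ?_
  filter_upwards [eventually_ge_atTop 0] with κ hκ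
  have hsqrt : ENNReal.ofReal κ = ENNReal.ofReal √κ * ENNReal.ofReal √κ := by
    rw [← ENNReal.ofReal_mul (Real.sqrt_nonneg κ), Real.mul_self_sqrt hκ]
  rw [hsqrt, ENNReal.mul_div_mul_comm (Or.inr ENNReal.ofReal_ne_top)
    (Or.inl ENNReal.ofReal_ne_top)]

end IsLittleOSqrt

section ErrorBound

variable {𝓗 : Type*} [NormedAddCommGroup 𝓗] [InnerProductSpace ℂ 𝓗]
  {m : ℕ} {T κ : ℝ} {E : Fin m → ℝ → ℝ} {P : Fin m → ℝ → 𝓗 →L[ℂ] 𝓗} {G : ℝ → 𝓗 →L[ℂ] 𝓗}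

lemma errorBound_eq_top [Nontrivial (Fin m)] (hT : 0 < T)
    (hG : supNorm T (timeDeriv T G) = ⊤) : errorBound T E P G κ = ⊤ := by
  have hT₀ : ENNReal.ofReal T ≠ 0 := (ENNReal.ofReal_pos.2 hT).ne'
  have hm : ENNReal.ofReal √m ≠ 0 :=
    (ENNReal.ofReal_pos.2 (Real.sqrt_pos.2 (Nat.cast_pos.2 (Fin.pos' (n := m))))).ne'
  have hη : ENNReal.ofReal κ * minGap T E ≠ ⊤ :=
    ENNReal.mul_ne_top ENNReal.ofReal_ne_top (minGap_ne_top hT.le)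
  rw [errorBound, hG, add_top, top_add, ENNReal.mul_top hT₀, add_top, ENNReal.mul_top]
  exact mul_ne_zero (ENNReal.div_pos hm hη).ne' (by simp)

lemma toReal_errorBound (hT : 0 ≤ T) (hκ : 0 ≤ κ) (hη : minGap T E ≠ 0) (hη' : maxSlope T E ≠ ⊤)
    (ha : supNorm T (connection T P) ≠ ⊤) (ha' : supNorm T (timeDeriv T (connection T P)) ≠ ⊤)
    (hg : supNorm T G ≠ ⊤) (hg' : supNorm T (timeDeriv T G) ≠ ⊤) :
    (errorBound T E P G κ).toReal
      = √m / (κ * (minGap T E).toReal)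
        * (1 + T * (supNorm T (connection T P)).toReal + 2 * T * (supNorm T G).toReal)
        * ((2 + (maxSlope T E).toReal / (minGap T E).toReal * T)
            * ((supNorm T (connection T P)).toReal + (supNorm T G).toReal)
          + T * ((supNorm T (timeDeriv T (connection T P))).toReal
            + (supNorm T (timeDeriv T G)).toReal
            + 2 * (supNorm T (connection T P)).toReal * (supNorm T G).toReal)) := by
  have hslope : maxSlope T E / minGap T E * ENNReal.ofReal T ≠ ⊤ :=
    ENNReal.mul_ne_top (ENNReal.div_ne_top hη' hη) ENNReal.ofReal_ne_top
  rw [errorBound, ENNReal.toReal_mul, ENNReal.toReal_mul, ENNReal.toReal_div,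
    ENNReal.toReal_add (by finiteness) (by finiteness),
    ENNReal.toReal_add (by finiteness) (by finiteness),
    ENNReal.toReal_add (by finiteness) (by finiteness)]
  simp only [ENNReal.toReal_mul]
  rw [ENNReal.toReal_add ha hg, ENNReal.toReal_add ENNReal.ofNat_ne_top hslope,
    ENNReal.toReal_add (by finiteness) (by finiteness), ENNReal.toReal_add ha' hg']
  simp only [ENNReal.toReal_mul, ENNReal.toReal_div, ENNReal.toReal_ofReal hT,
    ENNReal.toReal_ofReal hκ, ENNReal.toReal_ofReal (Real.sqrt_nonneg _), ENNReal.toReal_one,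
    ENNReal.toReal_ofNat]

end ErrorBound

namespace IsAdiabatic

variable {𝓗 : Type*} [NormedAddCommGroup 𝓗] [InnerProductSpace ℂ 𝓗] [CompleteSpace 𝓗]
  {m : ℕ} {T : ℝ} {H₀ : ℝ → 𝓗 →L[ℂ] 𝓗} {E : Fin m → ℝ → ℝ} {P : Fin m → ℝ → 𝓗 →L[ℂ] 𝓗}
  (h : IsAdiabatic T H₀ E P)
include h

lemma minGap_ne_zero : minGap T E ≠ 0 :=
  GenAdiabatic.minGap_ne_zero (fun l => (h.contDiff_E l).continuousOn)
    fun k l hkl t ht => sub_ne_zero.1 (abs_pos.1 (h.noCrossing k l hkl t ht))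

lemma maxSlope_ne_top (hT : 0 < T) : maxSlope T E ≠ ⊤ :=
  GenAdiabatic.maxSlope_ne_top hT h.contDiff_E

lemma supNorm_connection_ne_top (hT : 0 < T) : supNorm T (connection T P) ≠ ⊤ :=
  supNorm_ne_top (h.contDiffOn_connection hT).continuousOn

lemma supNorm_timeDeriv_connection_ne_top (hT : 0 < T) :
    supNorm T (timeDeriv T (connection T P)) ≠ ⊤ :=
  supNorm_ne_top
    ((h.contDiffOn_connection hT).continuousOn_derivWithin (uniqueDiffOn_Icc hT) le_rfl)

lemma adiabaticEvolution_eq_of_subsingleton [Subsingleton (Fin m)] (hT : 0 < T)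
    (G : ℝ → 𝓗 →L[ℂ] 𝓗) (κ : ℝ) {t : ℝ} (ht : t ∈ Icc 0 T) :
    adiabaticEvolution T H₀ P G κ t = timeOrderedExp (fun s => (κ : ℂ) • H₀ s + G s) t := by
  refine timeOrderedExp_congr (fun s hs => ?_) ht
  have hzeno : zeno P G s = G s := sum_mul_mul_eq_of_subsingleton (h.complete s hs) (G s)
  have hconn : connection T P s = 0 := by
    rw [← sum_mul_mul_eq_of_subsingleton (h.complete s hs) (connection T P s)]
    exact Finset.sum_eq_zero fun l _ => h.proj_mul_connection_mul_proj hT hs l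
  simp only [hzeno, hconn, add_zero]

theorem enorm_evolution_sub_le (hT : 0 < T) {G : ℝ → 𝓗 →L[ℂ] 𝓗}
    (hGsa : ∀ t ∈ Icc 0 T, IsSelfAdjoint (G t)) (hGd : DifferentiableOn ℝ G (Icc 0 T))
    {κ : ℝ} (hκ : 0 < κ) {t : ℝ} (ht : t ∈ Icc 0 T) :
    ‖timeOrderedExp (fun s => (κ : ℂ) • H₀ s + G s) t - adiabaticEvolution T H₀ P G κ t‖ₑ
      ≤ errorBound T E P G κ := by
  rcases subsingleton_or_nontrivial (Fin m) with hm | hm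
  · simp [h.adiabaticEvolution_eq_of_subsingleton hT G κ ht]
  by_cases hg' : supNorm T (timeDeriv T G) = ⊤
  · exact le_top.trans_eq (errorBound_eq_top hT hg').symm
  have hη := h.minGap_ne_zero
  have hη' := h.maxSlope_ne_top hT
  have ha := h.supNorm_connection_ne_top hT
  have ha' := h.supNorm_timeDeriv_connection_ne_top hT
  have hg := supNorm_ne_top hGd.continuousOn
  rw [← ofReal_norm]
  refine ENNReal.ofReal_le_of_le_toReal ?_
  rw [toReal_errorBound hT.le hκ.le hη hη' ha ha' hg hg']
  exact h.norm_evolution_sub_le hT hGsa hGd hκ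
    (ENNReal.toReal_pos hη (minGap_ne_top hT.le)) ENNReal.toReal_nonneg
    (fun k l hkl s => toReal_minGap_le hkl)
    (fun k l hkl s => abs_slope_le_toReal_maxSlope hη' hkl)
    (fun s => norm_le_toReal_supNorm ha) (fun s => norm_le_toReal_supNorm ha')
    (fun s => norm_le_toReal_supNorm hg) (fun s => norm_le_toReal_supNorm hg') ht

lemma tendsto_errorBound (hT : 0 < T) {G : ℝ → ℝ → 𝓗 →L[ℂ] 𝓗}
    (hg : IsLittleOSqrt fun κ => supNorm T (G κ))
    (hg' : IsLittleOSqrt fun κ => supNorm T (timeDeriv T (G κ))) :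
    Tendsto (fun κ => errorBound T E P (G κ) κ) atTop (𝓝 0) := by
  have hη := h.minGap_ne_zero
  have ha := h.supNorm_connection_ne_top hT
  have ha' := h.supNorm_timeDeriv_connection_ne_top hT
  have hslope : maxSlope T E / minGap T E * ENNReal.ofReal T ≠ ⊤ :=
    ENNReal.mul_ne_top (ENNReal.div_ne_top (h.maxSlope_ne_top hT) hη) ENNReal.ofReal_ne_top
  have hfactor₁ := (IsLittleOSqrt.const
      (c := 1 + ENNReal.ofReal T * supNorm T (connection T P)) (by finiteness)).add
    (hg.const_mul (c := 2 * ENNReal.ofReal T) (by finiteness))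
  have hfactor₂ := (((IsLittleOSqrt.const ha).add hg).const_mul
      (ENNReal.add_ne_top.2 ⟨ENNReal.ofNat_ne_top (n := 2), hslope⟩)).add
    ((((IsLittleOSqrt.const ha').add hg').add
        (hg.const_mul (c := 2 * supNorm T (connection T P)) (by finiteness))).const_mul
      (ENNReal.ofReal_ne_top (r := T)))
  have hprod := ENNReal.Tendsto.const_mul (hfactor₁.tendsto_mul_div hfactor₂)
    (Or.inr (ENNReal.div_ne_top (ENNReal.ofReal_ne_top (r := √m)) hη))
  rw [mul_zero] at hprod
  refine hprod.congr' ?_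
  filter_upwards [eventually_gt_atTop 0] with κ hκ
  rw [errorBound, div_eq_mul_inv (ENNReal.ofReal √m), div_eq_mul_inv (ENNReal.ofReal √m),
    ENNReal.mul_inv (Or.inl (ENNReal.ofReal_pos.2 hκ).ne') (Or.inl ENNReal.ofReal_ne_top),
    div_eq_mul_inv _ (ENNReal.ofReal κ)]
  ring

theorem tendstoUniformlyOn_evolution_sub (hT : 0 < T) {G : ℝ → ℝ → 𝓗 →L[ℂ] 𝓗}
    (hGsa : ∀ κ, 0 < κ → ∀ t ∈ Icc 0 T, IsSelfAdjoint (G κ t))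
    (hGd : ∀ κ, 0 < κ → DifferentiableOn ℝ (G κ) (Icc 0 T))
    (hg : IsLittleOSqrt fun κ => supNorm T (G κ))
    (hg' : IsLittleOSqrt fun κ => supNorm T (timeDeriv T (G κ))) :
    TendstoUniformlyOn (fun κ t : ℝ => timeOrderedExp (fun s => (κ : ℂ) • H₀ s + G κ s) t
      - adiabaticEvolution T H₀ P (G κ) κ t) (fun _ => 0) atTop (Icc 0 T) := by
  refine EMetric.tendstoUniformlyOn_iff.2 fun ε hε => ?_
  filter_upwards [(h.tendsto_errorBound hT hg hg').eventually_lt_const hε,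
    eventually_gt_atTop 0] with κ hlt hκ t ht
  rw [edist_comm, edist_zero_right]
  exact (h.enorm_evolution_sub_le hT (hGsa κ hκ) (hGd κ hκ) hκ ht).trans_lt hlt

end IsAdiabatic

section Remainder

variable {𝓗 : Type*} [NormedAddCommGroup 𝓗] [InnerProductSpace ℂ 𝓗]
  {m : ℕ} {T κ t : ℝ} {H₀ : ℝ → 𝓗 →L[ℂ] 𝓗} {E : Fin m → ℝ → ℝ} {P : Fin m → ℝ → 𝓗 →L[ℂ] 𝓗}
  {H : ℝ → ℝ → 𝓗 →L[ℂ] 𝓗}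

lemma smul_add_remainder (H : ℝ → ℝ → 𝓗 →L[ℂ] 𝓗) (H₀ : ℝ → 𝓗 →L[ℂ] 𝓗) (κ : ℝ) :
    (fun s => (κ : ℂ) • H₀ s + remainder H H₀ κ s) = H κ :=
  funext fun _ => add_sub_cancel _ _

lemma IsAdiabatic.isSelfAdjoint_remainder [CompleteSpace 𝓗] (h : IsAdiabatic T H₀ E P)
    (ht : t ∈ Icc 0 T) (hH : IsSelfAdjoint (H κ t)) : IsSelfAdjoint (remainder H H₀ κ t) :=
  hH.sub (IsSelfAdjoint.smul (Complex.conj_ofReal κ) (h.isSelfAdjoint_hamiltonian ht))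

end Remainder

end GenAdiabatic

theorem mainTheorem6 {𝓗 : Type*} [NormedAddCommGroup 𝓗] [InnerProductSpace ℂ 𝓗] [CompleteSpace 𝓗]
    {m : ℕ} (T : ℝ) (hT : 0 < T)
    (H₀ : ℝ → 𝓗 →L[ℂ] 𝓗) (E : Fin m → ℝ → ℝ) (P : Fin m → ℝ → 𝓗 →L[ℂ] 𝓗)
    (hH₀ : GenAdiabatic.IsAdiabatic T H₀ E P) :
    -- the generalized adiabatic theorem
    (∀ H : ℝ → ℝ → 𝓗 →L[ℂ] 𝓗,
      (∀ κ : ℝ, 0 < κ → MeasureTheory.IntegrableOn (H κ) (Set.Icc 0 T)) →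
      (∀ κ : ℝ, 0 < κ → ∀ t ∈ Set.Icc 0 T, IsSelfAdjoint (H κ t)) →
      (∀ t ∈ Set.Icc 0 T,
        Filter.Tendsto (fun κ : ℝ => (1 / κ : ℂ) • H κ t) Filter.atTop (nhds (H₀ t))) →
      (∀ κ : ℝ, 0 < κ → DifferentiableOn ℝ (GenAdiabatic.remainder H H₀ κ) (Set.Icc 0 T)) →
      Filter.Tendsto (fun κ : ℝ => GenAdiabatic.supNorm T (GenAdiabatic.remainder H H₀ κ)
        / ENNReal.ofReal (Real.sqrt κ)) Filter.atTop (nhds 0) →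
      Filter.Tendsto (fun κ : ℝ =>
        GenAdiabatic.supNorm T (GenAdiabatic.timeDeriv T (GenAdiabatic.remainder H H₀ κ))
          / ENNReal.ofReal (Real.sqrt κ)) Filter.atTop (nhds 0) →
      TendstoUniformlyOn
        (fun (κ t : ℝ) => GenAdiabatic.timeOrderedExp (H κ) t
          - GenAdiabatic.adiabaticEvolution T H₀ P (GenAdiabatic.remainder H H₀ κ) κ t)
        (fun _ => 0) Filter.atTop (Set.Icc 0 T) ∧
      ∀ κ : ℝ, 0 < κ → ∀ t ∈ Set.Icc 0 T,
        ‖GenAdiabatic.timeOrderedExp (H κ) t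
          - GenAdiabatic.adiabaticEvolution T H₀ P (GenAdiabatic.remainder H H₀ κ) κ t‖ₑ
          ≤ GenAdiabatic.errorBound T E P (GenAdiabatic.remainder H H₀ κ) κ) ∧
    -- the strong-coupling limit with time-dependent Hamiltonians
    (∀ H₁ : ℝ → 𝓗 →L[ℂ] 𝓗,
      (∀ t ∈ Set.Icc 0 T, IsSelfAdjoint (H₁ t)) →
      DifferentiableOn ℝ H₁ (Set.Icc 0 T) →
      GenAdiabatic.supNorm T (GenAdiabatic.timeDeriv T H₁) < ⊤ →
      TendstoUniformlyOn
        (fun (κ t : ℝ) => GenAdiabatic.timeOrderedExp (fun s => (κ : ℂ) • H₀ s + H₁ s) t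
          - GenAdiabatic.adiabaticEvolution T H₀ P H₁ κ t)
        (fun _ => 0) Filter.atTop (Set.Icc 0 T) ∧
      ∀ κ : ℝ, 0 < κ → ∀ t ∈ Set.Icc 0 T,
        ‖GenAdiabatic.timeOrderedExp (fun s => (κ : ℂ) • H₀ s + H₁ s) t
          - GenAdiabatic.adiabaticEvolution T H₀ P H₁ κ t‖ₑ
          ≤ GenAdiabatic.errorBound T E P H₁ κ) := by
  constructor
  · intro H _ hsa _ hd hg hg'
    have hGsa (κ : ℝ) (hκ : 0 < κ) (t : ℝ) (ht : t ∈ Set.Icc 0 T) :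
        IsSelfAdjoint (GenAdiabatic.remainder H H₀ κ t) :=
      hH₀.isSelfAdjoint_remainder ht (hsa κ hκ t ht)
    refine ⟨?_, fun κ hκ t ht => ?_⟩
    · simpa only [GenAdiabatic.smul_add_remainder] using
        hH₀.tendstoUniformlyOn_evolution_sub hT hGsa hd hg hg'
    · simpa only [GenAdiabatic.smul_add_remainder] using
        hH₀.enorm_evolution_sub_le hT (hGsa κ hκ) (hd κ hκ) hκ ht
  · intro H₁ hsa hd hd'
    exact ⟨hH₀.tendstoUniformlyOn_evolution_sub hT (fun _ _ => hsa) (fun _ _ => hd)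
        (.const (GenAdiabatic.supNorm_ne_top hd.continuousOn)) (.const hd'.ne),
      fun κ hκ t ht => hH₀.enorm_evolution_sub_le hT hsa hd hκ ht⟩
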